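/- Let $\kappa,\tau\in\mathbb R$ with $\tau\neq 0$ and $\kappa-4\tau^2\neq 0$, and let $\mathbb E(\kappa,\tau)$ be the simply connected homogeneous Riemannian $3$-manifold that fibers over the simply connected surface of constant curvature $\kappa$ with bundle curvature $\tau$ and unit vertical Killing field $\xi$, oriented so that $\overline\nabla_X\xi=\tau\,X\wedge\xi$ (a Berger sphere if $\kappa>0$, a Heisenberg space if $\kappa=0$, the universal cover of $\mathrm{PSL}(2,\mathbb R)$ if $\kappa<0$). For an oriented smooth surface $\Sigma$ immersed in $\mathbb E(\kappa,\tau)$ with unit normal $N$, put $AX=-\overline\nabla_XN$, $JX=N\wedge X$, $\nu=\langle N,\xi\rangle$ and $\mathbf T=\xi-\nu N$. It is an $H$-surface if its mean curvature $\frac12\operatorname{tr}A$ is the constant $H$. Its Abresch–Rosenberg shape operator is then $$S_{AR}X=AX-\alpha\langle\mathbf T_\theta,X\rangle\mathbf T_\theta+\frac{\alpha|\mathbf T|^2}{2}X-HX,$$ where $\alpha=\dfrac{\kappa-4\tau^2}{2\sqrt{H^2+\tau^2}}$, $e^{2i\theta}=\dfrac{H-i\tau}{\sqrt{H^2+\tau^2}}$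 and $\mathbf T_\theta=\cos\theta\,\mathbf T+\sin\theta\,J\mathbf T$. A smooth regular curve $\gamma:(-\varepsilon,\varepsilon)\to\Sigma$ is an AR-line of curvature of $\Sigma$ if $S_{AR}(\gamma'(t))=\lambda(t)\gamma'(t)$ for all $t$, for some smooth function $\lambda:(-\varepsilon,\varepsilon)\to\mathbb R$. **Corollary.** Let $\Sigma_1$ and $\Sigma_2$ be two $H$-surfaces in $\mathbb E(\kappa,\tau)$ (with the same constant $H$), with unit normals $N_1,N_2$ and angle functions $\nu_1,\nu_2$. Let $\Gamma\subset\Sigma_1\cap\Sigma_2$ be a smooth regular curve, parametrized on $(-\varepsilon,\varepsilon)$, along which the surfaces meet at a constant angle, that is, $\langle N_1,N_2\rangle$ is constant along $\Gamma$. Assume that 1. if $\Sigma_1$ and $\Sigma_2$ are tangent along $\Gamma$, then $N_1=N_2$ along $\Gamma$; 2. if $\Sigma_1$ and $\Sigma_2$ are transversal along $\Gamma$, then $\nu_1=-\nu_2$ along $\Gamma$. Then $\Gamma$ is an AR-line of curvature of $\Sigma_1$ if and only if it is an AR-line of curvature of $\Sigma_2$. -/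

import Mathlib

open scoped Manifold ContDiff Matrix

noncomputable section

namespace EKT

/-- The Euclidean space `ℝ⁴` in which the models of `𝔼(κ, τ)` lie as submanifolds. -/
abbrev V4 := EuclideanSpace ℝ (Fin 4)

/-! ### The homogeneous spaces `𝔼(κ, τ)`, `τ ≠ 0`

For `κ > 0` the model is the Berger sphere: the unit sphere `𝕊³` of the quaternions
`p 0 + p 1 i + p 2 j + p 3 k`, with orthonormal left-invariant fields
`(√κ / 2) p i`, `(√κ / 2) p j`, `(κ / (4 τ)) p k`.

For `κ ≤ 0` it is the set of the points `(x, y, z)` of `ℝ³ = ℝ³ × {0}` with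
`ρ = 1 + (κ / 4) (x² + y²) > 0` and the metric
`ρ⁻² (dx² + dy²) + (dz + τ ρ⁻¹ (y dx - x dy))²`
(Heisenberg space if `κ = 0`, the universal cover of `PSL(2, ℝ)` if `κ < 0`), with orthonormal
fields `ρ ∂x - τ y ∂z`, `ρ ∂y + τ x ∂z`, `∂z`.

In both cases the third field of the frame is the vertical field `ξ`, and the frame is positively
oriented. -/

/-- `ρ = 1 + (κ / 4) (x² + y²)`. -/
def rho (κ : ℝ) (p : V4) : ℝ := 1 + κ / 4 * (p 0 ^ 2 + p 1 ^ 2)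

/-- The underlying set of `𝔼(κ, τ)`. -/
def carrier (κ : ℝ) : Set V4 :=
  if 0 < κ then Metric.sphere 0 1 else {p | p 3 = 0 ∧ 0 < rho κ p}

/-- The positively oriented orthonormal frame `E₁, E₂, E₃ = ξ` (indexed by `0, 1, 2`). -/
def frame (κ τ : ℝ) (i : Fin 3) (p : V4) : V4 :=
  if 0 < κ then
    ![(√κ / 2) • !₂[-p 1, p 0, p 3, -p 2],
      (√κ / 2) • !₂[-p 2, -p 3, p 0, p 1],
      (κ / (4 * τ)) • !₂[-p 3, p 2, -p 1, p 0]] i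
  else
    ![!₂[rho κ p, 0, -(τ * p 1), 0],
      !₂[0, rho κ p, τ * p 0, 0],
      !₂[0, 0, 1, 0]] i

/-- The dual coframe: the coordinates of a tangent vector `v` at `p` in the frame. -/
def coframe (κ τ : ℝ) (p v : V4) : Fin 3 → ℝ :=
  if 0 < κ then
    ![2 / √κ * (-p 1 * v 0 + p 0 * v 1 + p 3 * v 2 - p 2 * v 3),
      2 / √κ * (-p 2 * v 0 - p 3 * v 1 + p 0 * v 2 + p 1 * v 3),
      4 * τ / κ * (-p 3 * v 0 + p 2 * v 1 - p 1 * v 2 + p 0 * v 3)]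
  else
    ![(rho κ p)⁻¹ * v 0,
      (rho κ p)⁻¹ * v 1,
      v 2 + τ * (rho κ p)⁻¹ * (p 1 * v 0 - p 0 * v 1)]

/-- `coframe` is dual to `frame` at the points of `𝔼(κ, τ)`. -/
theorem coframe_frame (κ τ : ℝ) (hτ : τ ≠ 0) (p : V4) (hp : p ∈ carrier κ) (i j : Fin 3) :
    coframe κ τ p (frame κ τ i p) j = if i = j then 1 else 0 := by
  by_cases h : 0 < κ
  · have hs : √κ ≠ 0 := by positivity
    have hn : p 0 ^ 2 + p 1 ^ 2 + p 2 ^ 2 + p 3 ^ 2 = 1 := by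
      simp [carrier, h, EuclideanSpace.norm_eq, Fin.sum_univ_four] at hp
      linarith
    fin_cases i <;> fin_cases j <;> simp [coframe, frame, h] <;> field_simp <;>
      first
      | linarith
      | (right; ring)
  · simp [carrier, h] at hp
    have := hp.2.ne'
    fin_cases i <;> fin_cases j <;> simp [coframe, frame, h] <;> field_simp <;> ring

/-- The tangent space of `𝔼(κ, τ)` at the point `p`, as a subspace of `ℝ⁴`. -/
def tangent (κ τ : ℝ) (p : V4) : Submodule ℝ V4 :=
  Submodule.span ℝ (Set.range fun i => frame κ τ i p)

/-- The Riemannian metric of `𝔼(κ, τ)` at `p`. -/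
def metric (κ τ : ℝ) (p u v : V4) : ℝ := coframe κ τ p u ⬝ᵥ coframe κ τ p v

/-- The vertical vector field `ξ`. -/
def xi (κ τ : ℝ) (p : V4) : V4 := frame κ τ 2 p

/-- The tangent vector at `p` with coordinates `a` in the frame. -/
def ofCoords (κ τ : ℝ) (p : V4) (a : Fin 3 → ℝ) : V4 := ∑ k, a k • frame κ τ k p

/-- The wedge (cross) product `u ∧ v` of tangent vectors at `p`. -/
def wedge (κ τ : ℝ) (p u v : V4) : V4 :=
  ofCoords κ τ p (coframe κ τ p u ⨯₃ coframe κ τ p v)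

/-- The structure functions `⟨[E_i, E_j], E_k⟩` of the frame. -/
def structureFun (κ τ : ℝ) (i j k : Fin 3) (p : V4) : ℝ :=
  coframe κ τ p (VectorField.lieBracket ℝ (frame κ τ i) (frame κ τ j) p) k

/-- The coefficients `⟨∇_{E_i} E_j, E_k⟩` of the Levi-Civita connection, by the Koszul formula
for an orthonormal frame. -/
def connCoeff (κ τ : ℝ) (i j k : Fin 3) (p : V4) : ℝ :=
  (structureFun κ τ i j k p - structureFun κ τ j k i p + structureFun κ τ k i j p) / 2

/-! ### The constants of the Abresch-Rosenberg shape operator -/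

/-- The angle `θ`, with `e^{2iθ} = (H - iτ) / √(H² + τ²)`. The operator `shapeAR` below depends on
`θ` modulo `π` only. -/
def theta (H τ : ℝ) : ℝ := Complex.arg (H - τ * Complex.I) / 2

theorem exp_theta (H τ : ℝ) (hτ : τ ≠ 0) :
    Complex.exp (2 * Complex.I * theta H τ) = (H - τ * Complex.I) / √(H ^ 2 + τ ^ 2) := by
  have h := Complex.norm_mul_exp_arg_mul_I ((H : ℂ) - τ * Complex.I)
  have hn : ‖(H : ℂ) - τ * Complex.I‖ = √(H ^ 2 + τ ^ 2) := by
    rw [Complex.norm_def, Complex.normSq_apply]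
    simp
    ring_nf
  have h0 : (√(H ^ 2 + τ ^ 2) : ℂ) ≠ 0 := by
    have : 0 < √(H ^ 2 + τ ^ 2) := by positivity
    exact_mod_cast this.ne'
  rw [hn] at h
  rw [eq_div_iff h0, mul_comm, theta]
  convert h using 3
  push_cast
  ring

/-- `α = (κ - 4 τ²) / (2 √(H² + τ²))`. -/
def alpha (κ τ H : ℝ) : ℝ := (κ - 4 * τ ^ 2) / (2 * √(H ^ 2 + τ ^ 2))

/-! ### Oriented immersed surfaces -/

section Surface

variable {S : Type*} [TopologicalSpace S] [ChartedSpace (EuclideanSpace ℝ (Fin 2)) S]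

/-- The differential at `x` of a map from a surface to `ℝ⁴`. -/
def diff (φ : S → V4) (x : S) : TangentSpace (𝓡 2) x →L[ℝ] V4 :=
  mfderiv (𝓡 2) 𝓘(ℝ, V4) φ x

/-- The derivative of a real function on a surface in the direction of the tangent vector `X`. -/
def dirDeriv (f : S → ℝ) (x : S) (X : TangentSpace (𝓡 2) x) : ℝ :=
  mfderiv (𝓡 2) 𝓘(ℝ, ℝ) f x X

/-- The Levi-Civita covariant derivative `∇_X W` of a vector field `W` of `𝔼(κ, τ)` along the
map `φ`, in the direction of the tangent vector `X` of the surface at `x`. -/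
def covDeriv (κ τ : ℝ) (φ W : S → V4) (x : S) (X : TangentSpace (𝓡 2) x) : V4 :=
  ofCoords κ τ (φ x) fun k =>
    dirDeriv (fun y => coframe κ τ (φ y) (W y) k) x X +
      ∑ i, ∑ j, coframe κ τ (φ x) (diff φ x X) i * coframe κ τ (φ x) (W x) j *
        connCoeff κ τ i j k (φ x)

variable (S) in
/-- A smooth oriented surface `S` immersed in `𝔼(κ, τ)`; the orientation is given by the unit
normal field `N`. -/
structure ImmersedSurface (κ τ : ℝ) where
  /-- the immersion -/
  φ : S → V4
  /-- the unit normal vector field -/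
  N : S → V4
  smooth_φ : ContMDiff (𝓡 2) 𝓘(ℝ, V4) ∞ φ
  mem_carrier : ∀ x, φ x ∈ carrier κ
  injective_diff : ∀ x, Function.Injective (diff φ x)
  smooth_N : ContMDiff (𝓡 2) 𝓘(ℝ, V4) ∞ N
  N_mem : ∀ x, N x ∈ tangent κ τ (φ x)
  N_unit : ∀ x, metric κ τ (φ x) (N x) (N x) = 1
  N_normal : ∀ x X, metric κ τ (φ x) (N x) (diff φ x X) = 0

namespace ImmersedSurface

variable {κ τ : ℝ} (M : ImmersedSurface S κ τ)

/-- The tangent plane of the immersed surface at `x`, as a subspace of `ℝ⁴`. -/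
def plane (x : S) : Submodule ℝ V4 := LinearMap.range (diff M.φ x).toLinearMap

/-- The angle function `ν = ⟨N, ξ⟩`. -/
def nu (x : S) : ℝ := metric κ τ (M.φ x) (M.N x) (xi κ τ (M.φ x))

/-- The tangent part `𝐓 = ξ - ν N` of the vertical field. -/
def T (x : S) : V4 := xi κ τ (M.φ x) - M.nu x • M.N x

/-- `J v = N ∧ v`. -/
def J (x : S) (v : V4) : V4 := wedge κ τ (M.φ x) (M.N x) v

/-- The shape operator `A X = -∇_X N` (its value is a vector of `ℝ⁴` tangent to the immersed
surface). -/
def shape (x : S) (X : TangentSpace (𝓡 2) x) : V4 := -covDeriv κ τ M.φ M.N x X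

/-- The first fundamental form. -/
def firstForm (x : S) (X Y : TangentSpace (𝓡 2) x) : ℝ :=
  metric κ τ (M.φ x) (diff M.φ x X) (diff M.φ x Y)

/-- The second fundamental form `II(X, Y) = ⟨A X, Y⟩`. -/
def secondForm (x : S) (X Y : TangentSpace (𝓡 2) x) : ℝ :=
  metric κ τ (M.φ x) (M.shape x X) (diff M.φ x Y)

/-- `M` is an `H`-surface: its mean curvature, i.e. half the trace of the shape operator (computed
in orthonormal bases of the tangent planes), is the constant `H`. -/
def IsHSurface (H : ℝ) : Prop :=
  ∀ (x : S) (X Y : TangentSpace (𝓡 2) x),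
    M.firstForm x X X = 1 → M.firstForm x Y Y = 1 → M.firstForm x X Y = 0 →
      (M.secondForm x X X + M.secondForm x Y Y) / 2 = H

/-- `𝐓_θ = cos θ 𝐓 + sin θ J 𝐓`. -/
def Ttheta (H : ℝ) (x : S) : V4 :=
  Real.cos (theta H τ) • M.T x + Real.sin (theta H τ) • M.J x (M.T x)

/-- The Abresch-Rosenberg shape operator of an `H`-surface (with values in `ℝ⁴`, tangent to the
immersed surface):
`S_AR X = A X - α ⟨𝐓_θ, X⟩ 𝐓_θ + (α |𝐓|² / 2) X - H X`. -/
def shapeAR (H : ℝ) (x : S) (X : TangentSpace (𝓡 2) x) : V4 :=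
  M.shape x X
    - (alpha κ τ H * metric κ τ (M.φ x) (M.Ttheta H x) (diff M.φ x X)) • M.Ttheta H x
    + (alpha κ τ H * metric κ τ (M.φ x) (M.T x) (M.T x) / 2) • diff M.φ x X
    - H • diff M.φ x X

end ImmersedSurface

/-- The velocity `γ'(t)` of a curve in a surface. -/
def velocity (γ : ℝ → S) (t : ℝ) : TangentSpace (𝓡 2) (γ t) :=
  mfderiv 𝓘(ℝ, ℝ) (𝓡 2) γ t (1 : ℝ)

/-- `γ` restricts to a smooth regular curve `(-ε, ε) → S`. -/
def IsRegularCurve (ε : ℝ) (γ : ℝ → S) : Prop :=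
  ContMDiffOn 𝓘(ℝ, ℝ) (𝓡 2) ∞ γ (Set.Ioo (-ε) ε) ∧ ∀ t ∈ Set.Ioo (-ε) ε, velocity γ t ≠ 0

/-- The curve `γ : (-ε, ε) → S` is an AR-line of curvature of the `H`-surface `M`:
`S_AR(γ') = l γ'` for a smooth function `l : (-ε, ε) → ℝ`. -/
def IsARLine {κ τ : ℝ} (M : ImmersedSurface S κ τ) (H ε : ℝ) (γ : ℝ → S) : Prop :=
  ∃ l : ℝ → ℝ, ContDiffOn ℝ ∞ l (Set.Ioo (-ε) ε) ∧
    ∀ t ∈ Set.Ioo (-ε) ε,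
      M.shapeAR H (γ t) (velocity γ t) = l t • diff M.φ (γ t) (velocity γ t)

end Surface

end EKT

end

/-!
The argument is Joachimsthal's. Since `S_AR` takes values in the tangent plane, which is two
dimensional, a regular curve `γ` is an AR-line of curvature if and only if `⟨S_AR(γ'), Jγ'⟩ = 0`
along it (`EKT.isARLine_iff`). It therefore suffices to see that this function is the same for both
surfaces.

Writing `⟨𝐓_θ, γ'⟩` and `⟨𝐓_θ, Jγ'⟩` in terms of `⟨ξ, γ'⟩` and `⟨ξ, Jγ'⟩` shows that
`⟨S_AR(γ'), Jγ'⟩` depends only on `⟨∇N, Jγ'⟩`, `⟨ξ, γ'⟩` and `⟨ξ, Jγ'⟩`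
(`EKT.arCoords_dotProduct_cross`). The middle term does not involve the surface. Let
`d = ⟨N₁, N₂⟩`, a constant.

If `d² = 1`, the surfaces are tangent along the curve, so `N₁ = N₂` along it and everything agrees.

If `d² ≠ 1`, the surfaces are transversal, so `ν₁ = -ν₂`, and `γ' = c N₁ ∧ N₂` at each point. Hence
`J₁γ' = c (d N₁ - N₂)` and `J₂γ' = c (N₁ - d N₂)`. As `∇N_i ⊥ N_i`, the terms `⟨∇N_i, J_iγ'⟩` are
`-c ⟨∇N₁, N₂⟩` and `c ⟨N₁, ∇N₂⟩`, which agree because the derivative of `⟨N₁, N₂⟩` vanishes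
(`EKT.covNormal_dotProduct_add`). The terms `⟨ξ, J_iγ'⟩` are `c (d ν₁ - ν₂)` and `c (ν₁ - d ν₂)`,
both equal to `c (d + 1) ν₁`. This is `EKT.dotProduct_cross_eq`.

All computations are made in `ℝ³`, with coordinates in the orthonormal frame. The only property of
the connection that matters is its compatibility with the metric, so the brackets of the frame
are never computed.
-/

open scoped Manifold ContDiff Matrix

noncomputable section

namespace EKT

variable {κ τ : ℝ}

/-! ### Linear algebra of the frame -/

/-- The coordinates in the frame at `p`, as a linear map. -/
def coframeLin (κ τ : ℝ) (p : V4) : V4 →ₗ[ℝ] (Fin 3 → ℝ) where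
  toFun := coframe κ τ p
  map_add' u v := by
    by_cases h : 0 < κ <;> ext k <;> fin_cases k <;> simp [coframe, h] <;> ring
  map_smul' c v := by
    by_cases h : 0 < κ <;> ext k <;> fin_cases k <;> simp [coframe, h] <;> ring

@[simp] theorem coframeLin_apply (p v : V4) : coframeLin κ τ p v = coframe κ τ p v := rfl

theorem coframe_add (p u v : V4) :
    coframe κ τ p (u + v) = coframe κ τ p u + coframe κ τ p v := (coframeLin κ τ p).map_add u v

theorem coframe_sub (p u v : V4) :
    coframe κ τ p (u - v) = coframe κ τ p u - coframe κ τ p v := (coframeLin κ τ p).map_sub u v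

theorem coframe_neg (p v : V4) :
    coframe κ τ p (-v) = -coframe κ τ p v := (coframeLin κ τ p).map_neg v

theorem coframe_smul (p : V4) (c : ℝ) (v : V4) :
    coframe κ τ p (c • v) = c • coframe κ τ p v := (coframeLin κ τ p).map_smul c v

theorem coframe_ofCoords (hτ : τ ≠ 0) {p : V4} (hp : p ∈ carrier κ) (a : Fin 3 → ℝ) :
    coframe κ τ p (ofCoords κ τ p a) = a := by
  change coframeLin κ τ p (ofCoords κ τ p a) = a
  ext j
  simp only [ofCoords, map_sum, map_smul, coframeLin_apply, Finset.sum_apply, Pi.smul_apply,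
    coframe_frame κ τ hτ p hp, smul_eq_mul, mul_ite, mul_one, mul_zero, Finset.sum_ite_eq',
    Finset.mem_univ, if_true]

theorem coframe_xi (hτ : τ ≠ 0) {p : V4} (hp : p ∈ carrier κ) :
    coframe κ τ p (xi κ τ p) = ![0, 0, 1] := by
  ext j
  rw [xi, coframe_frame κ τ hτ p hp]
  fin_cases j <;> simp

theorem frame_mem_tangent (p : V4) (i : Fin 3) : frame κ τ i p ∈ tangent κ τ p :=
  Submodule.subset_span ⟨i, rfl⟩

theorem ofCoords_mem_tangent (p : V4) (a : Fin 3 → ℝ) : ofCoords κ τ p a ∈ tangent κ τ p :=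
  Submodule.sum_mem _ fun i _ => Submodule.smul_mem _ _ (frame_mem_tangent p i)

theorem ofCoords_coframe (hτ : τ ≠ 0) {p v : V4} (hp : p ∈ carrier κ)
    (hv : v ∈ tangent κ τ p) : ofCoords κ τ p (coframe κ τ p v) = v := by
  obtain ⟨a, rfl⟩ := (Submodule.mem_span_range_iff_exists_fun ℝ).1 hv
  exact congrArg _ (coframe_ofCoords hτ hp a)

theorem coframe_injOn (hτ : τ ≠ 0) {p : V4} (hp : p ∈ carrier κ) :
    Set.InjOn (coframe κ τ p) (tangent κ τ p) := fun u hu v hv h => by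
  rw [← ofCoords_coframe hτ hp hu, h, ofCoords_coframe hτ hp hv]

/-- At a point of the sphere the tangent space contains the orthogonal complement of the point. -/
theorem mem_tangent_of_inner_eq_zero (hτ : τ ≠ 0) (h : 0 < κ) {p v : V4} (hp : p ∈ carrier κ)
    (hv : inner ℝ p v = 0) : v ∈ tangent κ τ p := by
  have hn : p 0 ^ 2 + p 1 ^ 2 + p 2 ^ 2 + p 3 ^ 2 = 1 := by
    simp [carrier, h, EuclideanSpace.norm_eq, Fin.sum_univ_four] at hp
    linarith
  have hs : √κ ≠ 0 := by positivity
  simp [PiLp.inner_apply, Fin.sum_univ_four] at hv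
  have : v = ofCoords κ τ p (coframe κ τ p v) := by
    ext j
    fin_cases j <;>
      simp [ofCoords, coframe, frame, h, Fin.sum_univ_three] <;> field_simp
    · linear_combination (-v 0) * hn + p 0 * hv
    · linear_combination (-v 1) * hn + p 1 * hv
    · linear_combination (-v 2) * hn + p 2 * hv
    · linear_combination (-v 3) * hn + p 3 * hv
  rw [this]
  exact ofCoords_mem_tangent _ _

theorem mem_tangent_of_apply_three_eq_zero (h : ¬0 < κ) {p v : V4} (hp : p ∈ carrier κ)
    (hv : v 3 = 0) : v ∈ tangent κ τ p := by
  simp [carrier, h] at hp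
  have hr := hp.2.ne'
  have : v = ofCoords κ τ p (coframe κ τ p v) := by
    ext j
    fin_cases j <;> simp [ofCoords, coframe, frame, h, Fin.sum_univ_three]
    · field_simp
    · field_simp
    · field_simp
      ring
    · exact hv
  rw [this]
  exact ofCoords_mem_tangent _ _

/-! ### Metric compatibility of the connection -/

theorem structureFun_swap (i j k : Fin 3) (p : V4) :
    structureFun κ τ i j k p = -structureFun κ τ j i k p := by
  rw [structureFun, VectorField.lieBracket_swap, coframe_neg]
  rfl

/-- The Koszul coefficients are skew in the last two indices, i.e. the connection is metric. -/
theorem connCoeff_swap (i j k : Fin 3) (p : V4) :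
    connCoeff κ τ i j k p = -connCoeff κ τ i k j p := by
  rw [connCoeff, connCoeff, structureFun_swap i k j, structureFun_swap k j i,
    structureFun_swap j i k]
  ring

/-- The algebraic part of the covariant derivative: the coordinates of `∇_u n` for `n` with
constant coordinates. -/
def connTerm (κ τ : ℝ) (p : V4) (u n : Fin 3 → ℝ) : Fin 3 → ℝ :=
  fun k => ∑ i, ∑ j, u i * n j * connCoeff κ τ i j k p

theorem connTerm_dotProduct_add (p : V4) (u m n : Fin 3 → ℝ) :
    connTerm κ τ p u m ⬝ᵥ n + m ⬝ᵥ connTerm κ τ p u n = 0 := by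
  have h : ∀ i j, connCoeff κ τ i j j p = 0 := fun i j => by
    linarith [connCoeff_swap (κ := κ) (τ := τ) i j j p]
  simp only [connTerm, dotProduct, Fin.sum_univ_three, h, connCoeff_swap _ 1 0,
    connCoeff_swap _ 2 0, connCoeff_swap _ 2 1]
  ring

/-! ### Smoothness of the coframe and of the connection -/

theorem contDiff_frame (i : Fin 3) : ContDiff ℝ ∞ (frame κ τ i) := by
  rw [contDiff_euclidean]
  intro k
  by_cases h : 0 < κ <;> fin_cases i <;> fin_cases k <;> simp [frame, h, rho] <;> fun_prop

theorem contDiffAt_coframe {p : V4} (hp : p ∈ carrier κ) (v : V4) (k : Fin 3) :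
    ContDiffAt ℝ ∞ (fun q : V4 × V4 => coframe κ τ q.1 q.2 k) (p, v) := by
  by_cases h : 0 < κ
  · fin_cases k <;> simp [coframe, h] <;> fun_prop
  · simp [carrier, h] at hp
    have hr := hp.2.ne'
    have : ContDiffAt ℝ ∞ (fun q : V4 × V4 => (rho κ q.1)⁻¹) (p, v) := by
      refine ContDiffAt.inv ?_ hr
      simp only [rho]
      fun_prop
    fin_cases k <;> simp [coframe, h] <;> fun_prop

theorem contDiffAt_connCoeff {p : V4} (hp : p ∈ carrier κ) (i j k : Fin 3) :
    ContDiffAt ℝ ∞ (connCoeff κ τ i j k) p := by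
  have hs : ∀ i j k, ContDiffAt ℝ ∞ (structureFun κ τ i j k) p := fun i j k => by
    have hb : ContDiffAt ℝ ∞ (VectorField.lieBracket ℝ (frame κ τ i) (frame κ τ j)) p :=
      ContDiffAt.lieBracket_vectorField (contDiff_frame i).contDiffAt (contDiff_frame j).contDiffAt
        le_rfl
    exact ContDiffAt.comp (g := fun q : V4 × V4 => coframe κ τ q.1 q.2 k)
      (f := fun q => (q, VectorField.lieBracket ℝ (frame κ τ i) (frame κ τ j) q)) p
      (contDiffAt_coframe hp _ k) (contDiffAt_id.prodMk hb)
  exact (((hs i j k).sub (hs j k i)).add (hs k i j)).div_const 2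

/-! ### Vector algebra in `ℝ³` -/

section Algebra

variable {n u : Fin 3 → ℝ}

/-- Expansion of a vector `s` in the basis `a`, `b`, `a ∧ b`, multiplied by `|a ∧ b|²`. -/
theorem gram_smul_eq (a b s : Fin 3 → ℝ) :
    ((a ⬝ᵥ a) * (b ⬝ᵥ b) - (a ⬝ᵥ b) ^ 2) • s =
      ((s ⬝ᵥ a) * (b ⬝ᵥ b) - (s ⬝ᵥ b) * (a ⬝ᵥ b)) • a +
      ((s ⬝ᵥ b) * (a ⬝ᵥ a) - (s ⬝ᵥ a) * (a ⬝ᵥ b)) • b + (s ⬝ᵥ (a ⨯₃ b)) • (a ⨯₃ b) := by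
  ext k
  fin_cases k <;> simp [cross_apply, dotProduct, Fin.sum_univ_three] <;> ring

/-- A vector orthogonal to `n` and to `n ∧ u`, where `n` is a unit vector and `u ≠ 0` is
orthogonal to `n`, is a multiple of `u`. -/
theorem eq_smul_of_orthogonal (hn : n ⬝ᵥ n = 1) (hu : n ⬝ᵥ u = 0) (hu0 : u ≠ 0) {s : Fin 3 → ℝ}
    (hs : s ⬝ᵥ n = 0) (hs' : s ⬝ᵥ (n ⨯₃ u) = 0) : s = ((s ⬝ᵥ u) / (u ⬝ᵥ u)) • u := by
  have hq : u ⬝ᵥ u ≠ 0 := fun h => hu0 (dotProduct_self_eq_zero.1 h)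
  have key : (u ⬝ᵥ u) • s = (s ⬝ᵥ u) • u := by
    simpa [hn, hu, hs, hs'] using gram_smul_eq n u s
  rw [div_eq_inv_mul, mul_smul, ← key, smul_smul, inv_mul_cancel₀ hq, one_smul]

/-- A vector orthogonal to two non-parallel unit vectors is a multiple of their cross product. -/
theorem exists_eq_smul_cross {m : Fin 3 → ℝ} (hn : n ⬝ᵥ n = 1) (hm : m ⬝ᵥ m = 1)
    (hnm : (n ⬝ᵥ m) ^ 2 ≠ 1) (hnu : n ⬝ᵥ u = 0) (hmu : m ⬝ᵥ u = 0) :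
    ∃ c : ℝ, u = c • (n ⨯₃ m) := by
  have hq : 1 - (n ⬝ᵥ m) ^ 2 ≠ 0 := fun h => hnm (by linarith)
  rw [dotProduct_comm] at hnu hmu
  have key : (1 - (n ⬝ᵥ m) ^ 2) • u = (u ⬝ᵥ (n ⨯₃ m)) • (n ⨯₃ m) := by
    simpa [hn, hm, hnu, hmu] using gram_smul_eq n m u
  refine ⟨(u ⬝ᵥ (n ⨯₃ m)) / (1 - (n ⬝ᵥ m) ^ 2), ?_⟩
  rw [div_eq_inv_mul, mul_smul, ← key, smul_smul, inv_mul_cancel₀ hq, one_smul]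

/-- Two unit vectors whose inner product is `±1` are equal or opposite. -/
theorem eq_or_eq_neg_of_dotProduct_sq {m : Fin 3 → ℝ} (hn : n ⬝ᵥ n = 1) (hm : m ⬝ᵥ m = 1)
    (hnm : (n ⬝ᵥ m) ^ 2 = 1) : m = n ∨ m = -n := by
  rw [sq, mul_self_eq_one_iff] at hnm
  rcases hnm with h | h
  · left
    rw [← sub_eq_zero, ← dotProduct_self_eq_zero]
    simp [sub_dotProduct, dotProduct_sub, hn, hm, h, dotProduct_comm m n]
  · right
    rw [← add_eq_zero_iff_eq_neg, ← dotProduct_self_eq_zero]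
    simp [add_dotProduct, dotProduct_add, hn, hm, h, dotProduct_comm m n]

/-- The coordinates of `𝐓_θ` in terms of those of `N` and of `ξ`, with `c = cos θ`,
`s = sin θ`. -/
def rotT (c s : ℝ) (n e : Fin 3 → ℝ) : Fin 3 → ℝ :=
  c • (e - (n ⬝ᵥ e) • n) + s • (n ⨯₃ (e - (n ⬝ᵥ e) • n))

theorem rotT_dotProduct_normal (c s : ℝ) (n e : Fin 3 → ℝ) (hn : n ⬝ᵥ n = 1) :
    rotT c s n e ⬝ᵥ n = 0 := by
  have h : (n ⨯₃ (e - (n ⬝ᵥ e) • n)) ⬝ᵥ n = 0 := by rw [dotProduct_comm, dot_self_cross]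
  rw [rotT, add_dotProduct, smul_dotProduct, smul_dotProduct, h, sub_dotProduct, smul_dotProduct,
    hn, dotProduct_comm e n]
  simp

theorem rotT_dotProduct (c s : ℝ) (e : Fin 3 → ℝ) (hu : n ⬝ᵥ u = 0) :
    rotT c s n e ⬝ᵥ u = c * (e ⬝ᵥ u) - s * (e ⬝ᵥ (n ⨯₃ u)) := by
  simp only [rotT, cross_apply, dotProduct, Fin.sum_univ_three, Pi.add_apply, Pi.sub_apply,
    Pi.smul_apply, smul_eq_mul, Matrix.cons_val] at hu ⊢
  linear_combination (-c * (n 0 * e 0 + n 1 * e 1 + n 2 * e 2)) * hu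

theorem rotT_dotProduct_cross (c s : ℝ) (e : Fin 3 → ℝ) (hn : n ⬝ᵥ n = 1) (hu : n ⬝ᵥ u = 0) :
    rotT c s n e ⬝ᵥ (n ⨯₃ u) = c * (e ⬝ᵥ (n ⨯₃ u)) + s * (e ⬝ᵥ u) := by
  have h := rotT_dotProduct c s e (dot_self_cross n u)
  have h' : n ⨯₃ (n ⨯₃ u) = -u := by
    rw [cross_cross_eq_smul_sub_smul', hu, hn]; simp
  rw [h, h', dotProduct_neg]
  ring

/-- Joachimsthal's computation. The unit vectors `n`, `m` are the normals of two surfaces meeting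
along a curve with velocity `u`, the vectors `a`, `b` their covariant derivatives along the curve,
and `e` is the vertical field. The geodesic torsion terms `⟨∇_u N, N ∧ u⟩` of the two surfaces
agree because the angle is constant, and the terms `⟨ξ, N ∧ u⟩` agree because the angle functions
are opposite. -/
theorem dotProduct_cross_eq {m : Fin 3 → ℝ} {a b e : Fin 3 → ℝ} (hn : n ⬝ᵥ n = 1)
    (hm : m ⬝ᵥ m = 1) (hnm : (n ⬝ᵥ m) ^ 2 ≠ 1) (hnu : n ⬝ᵥ u = 0) (hmu : m ⬝ᵥ u = 0)
    (ha : a ⬝ᵥ n = 0) (hb : b ⬝ᵥ m = 0) (hab : a ⬝ᵥ m + n ⬝ᵥ b = 0)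
    (he : n ⬝ᵥ e = -(m ⬝ᵥ e)) :
    a ⬝ᵥ (n ⨯₃ u) = b ⬝ᵥ (m ⨯₃ u) ∧ e ⬝ᵥ (n ⨯₃ u) = e ⬝ᵥ (m ⨯₃ u) := by
  obtain ⟨c, rfl⟩ := exists_eq_smul_cross hn hm hnm hnu hmu
  have h₁ : n ⨯₃ (c • (n ⨯₃ m)) = c • ((n ⬝ᵥ m) • n - m) := by
    rw [map_smul, cross_cross_eq_smul_sub_smul', hn, one_smul]
  have h₂ : m ⨯₃ (c • (n ⨯₃ m)) = c • (n - (n ⬝ᵥ m) • m) := by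
    rw [map_smul, cross_cross_eq_smul_sub_smul', hm, one_smul]
  rw [h₁, h₂]
  constructor
  · simp only [dotProduct_smul, dotProduct_sub, smul_eq_mul, ha, hb, dotProduct_comm b n]
    linear_combination (-c) * hab
  · rw [dotProduct_comm e, dotProduct_comm e]
    simp only [smul_dotProduct, sub_dotProduct, smul_eq_mul, he]
    ring

end Algebra

/-! ### Calculus of dot and cross products -/

theorem contDiffOn_dotProduct {s : Set ℝ} {f g : ℝ → Fin 3 → ℝ} (hf : ContDiffOn ℝ ∞ f s)
    (hg : ContDiffOn ℝ ∞ g s) : ContDiffOn ℝ ∞ (fun t => f t ⬝ᵥ g t) s :=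
  ContDiffOn.sum fun i _ => (contDiffOn_pi.1 hf i).mul (contDiffOn_pi.1 hg i)

theorem contDiffOn_cross {s : Set ℝ} {f g : ℝ → Fin 3 → ℝ} (hf : ContDiffOn ℝ ∞ f s)
    (hg : ContDiffOn ℝ ∞ g s) : ContDiffOn ℝ ∞ (fun t => f t ⨯₃ g t) s := by
  have hf' := contDiffOn_pi.1 hf
  have hg' := contDiffOn_pi.1 hg
  refine contDiffOn_pi.2 fun k => ?_
  fin_cases k <;> simp only [cross_apply] <;>
    exact ((hf' _).mul (hg' _)).sub ((hf' _).mul (hg' _))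

theorem hasDerivAt_dotProduct {f g : ℝ → Fin 3 → ℝ} {t : ℝ} (hf : DifferentiableAt ℝ f t)
    (hg : DifferentiableAt ℝ g t) :
    HasDerivAt (fun s => f s ⬝ᵥ g s) (deriv f t ⬝ᵥ g t + f t ⬝ᵥ deriv g t) t := by
  have hf' := hasDerivAt_pi.1 hf.hasDerivAt
  have hg' := hasDerivAt_pi.1 hg.hasDerivAt
  have := HasDerivAt.fun_sum (u := Finset.univ) fun i _ => (hf' i).mul (hg' i)
  rw [Finset.sum_add_distrib] at this
  exact this

section Surface

variable {S : Type*} [TopologicalSpace S] [ChartedSpace (EuclideanSpace ℝ (Fin 2)) S]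

/-! ### Curves in a surface -/

theorem dirDeriv_velocity {f : S → ℝ} (hf : ContMDiff (𝓡 2) 𝓘(ℝ, ℝ) ∞ f)
    {ε : ℝ} {γ : ℝ → S} (hγ : IsRegularCurve ε γ) {t : ℝ} (ht : t ∈ Set.Ioo (-ε) ε) :
    dirDeriv f (γ t) (velocity γ t) = deriv (fun s => f (γ s)) t := by
  have hd : MDifferentiableAt 𝓘(ℝ, ℝ) (𝓡 2) γ t :=
    (hγ.1.contMDiffAt (isOpen_Ioo.mem_nhds ht)).mdifferentiableAt (by simp)
  have h := mfderiv_comp_apply (I'' := 𝓘(ℝ, ℝ)) t (g := f) (f := γ)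
    (hf.contMDiffAt.mdifferentiableAt (by simp)) hd (1 : ℝ)
  rw [mfderiv_eq_fderiv] at h
  exact h.symm.trans (fderiv_apply_one_eq_deriv (𝕜 := ℝ) (f := fun s => f (γ s)))

theorem contDiffOn_comp {E : Type*} [NormedAddCommGroup E] [NormedSpace ℝ E] {f : S → E}
    (hf : ContMDiff (𝓡 2) 𝓘(ℝ, E) ∞ f) {ε : ℝ} {γ : ℝ → S} (hγ : IsRegularCurve ε γ) :
    ContDiffOn ℝ ∞ (fun s => f (γ s)) (Set.Ioo (-ε) ε) :=
  contMDiffOn_iff_contDiffOn.1 (hf.comp_contMDiffOn hγ.1)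

/-! ### Tangent planes of an immersed surface -/

namespace ImmersedSurface

variable (M : ImmersedSurface S κ τ)

theorem mdifferentiableAt_φ (x : S) : MDifferentiableAt (𝓡 2) 𝓘(ℝ, V4) M.φ x :=
  M.smooth_φ.contMDiffAt.mdifferentiableAt (by simp)

/-- The differential of a function which is constant on `𝔼(κ, τ)` vanishes on the tangent planes of
an immersed surface. -/
theorem fderiv_apply_diff_eq_zero {f : V4 → ℝ} (hf : Differentiable ℝ f) {c : ℝ}
    (hc : ∀ p ∈ carrier κ, f p = c) (x : S) (X : TangentSpace (𝓡 2) x) :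
    fderiv ℝ f (M.φ x) (diff M.φ x X) = 0 := by
  have h := mfderiv_comp_apply (I'' := 𝓘(ℝ, ℝ)) x (g := f) (f := M.φ)
    (hf (M.φ x)).mdifferentiableAt (M.mdifferentiableAt_φ x) X
  have hconst : f ∘ M.φ = fun _ => c := funext fun y => hc _ (M.mem_carrier y)
  rw [hconst, mfderiv_const, mfderiv_eq_fderiv] at h
  exact h.symm

theorem diff_mem_tangent (hτ : τ ≠ 0) (x : S) (X : TangentSpace (𝓡 2) x) :
    diff M.φ x X ∈ tangent κ τ (M.φ x) := by
  by_cases h : 0 < κ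
  · refine mem_tangent_of_inner_eq_zero hτ h (M.mem_carrier x) ?_
    have := M.fderiv_apply_diff_eq_zero (f := fun p => ‖p‖ ^ 2) (c := 1)
      (contDiff_norm_sq ℝ (n := 1)).differentiable_one
      (fun p hp => by simp [carrier, h] at hp; simp [hp]) x X
    rw [fderiv_norm_sq_apply] at this
    simpa using this
  · refine mem_tangent_of_apply_three_eq_zero h (M.mem_carrier x) ?_
    have := M.fderiv_apply_diff_eq_zero (f := fun p => EuclideanSpace.proj (𝕜 := ℝ) (3 : Fin 4) p)
      (c := 0) (ContinuousLinearMap.differentiable _)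
      (fun p hp => by simp [carrier, h] at hp; simp [hp]) x X
    rw [ContinuousLinearMap.fderiv] at this
    simpa using this

/-- The coordinates of the unit normal in the frame. -/
def normalCoords (x : S) : Fin 3 → ℝ := coframe κ τ (M.φ x) (M.N x)

theorem normalCoords_self (x : S) : M.normalCoords x ⬝ᵥ M.normalCoords x = 1 := M.N_unit x

theorem normalCoords_diff (x : S) (X : TangentSpace (𝓡 2) x) :
    M.normalCoords x ⬝ᵥ coframe κ τ (M.φ x) (diff M.φ x X) = 0 := M.N_normal x X

/-- In coordinates the tangent plane is the whole orthogonal complement of the normal. -/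
theorem exists_coframe_diff_eq (hτ : τ ≠ 0) (x : S) {a : Fin 3 → ℝ}
    (ha : M.normalCoords x ⬝ᵥ a = 0) : ∃ X, coframe κ τ (M.φ x) (diff M.φ x X) = a := by
  let C : TangentSpace (𝓡 2) x →ₗ[ℝ] (Fin 3 → ℝ) :=
    coframeLin κ τ (M.φ x) ∘ₗ (diff M.φ x).toLinearMap
  let n : Module.Dual ℝ (Fin 3 → ℝ) := dotProductBilin ℝ ℝ (M.normalCoords x)
  have hC : Function.Injective C := fun X Y h => M.injective_diff x
    (coframe_injOn hτ (M.mem_carrier x) (M.diff_mem_tangent hτ x X) (M.diff_mem_tangent hτ x Y) h)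
  have hn : n ≠ 0 := fun h => by
    have h' : M.normalCoords x ⬝ᵥ M.normalCoords x = 0 := LinearMap.congr_fun h (M.normalCoords x)
    rw [M.normalCoords_self] at h'
    exact one_ne_zero h'
  have hle : LinearMap.range C ≤ LinearMap.ker n := by
    rintro _ ⟨X, rfl⟩
    exact M.normalCoords_diff x X
  have hr : Module.finrank ℝ (LinearMap.range C) = 2 := by
    rw [LinearMap.finrank_range_of_inj hC]
    exact finrank_euclideanSpace_fin
  have hk := Module.Dual.finrank_ker_add_one_of_ne_zero hn
  rw [Module.finrank_fin_fun] at hk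
  have heq := Submodule.eq_of_le_of_finrank_eq hle (by omega)
  have : a ∈ LinearMap.range C := heq ▸ ha
  exact this

theorem mem_plane_iff (hτ : τ ≠ 0) (x : S) (v : V4) :
    v ∈ M.plane x ↔
      v ∈ tangent κ τ (M.φ x) ∧ M.normalCoords x ⬝ᵥ coframe κ τ (M.φ x) v = 0 := by
  constructor
  · rintro ⟨X, rfl⟩
    exact ⟨M.diff_mem_tangent hτ x X, M.normalCoords_diff x X⟩
  · rintro ⟨hv, h⟩
    obtain ⟨X, hX⟩ := M.exists_coframe_diff_eq hτ x h
    exact ⟨X, coframe_injOn hτ (M.mem_carrier x) (M.diff_mem_tangent hτ x X) hv hX⟩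

theorem T_mem_tangent (x : S) : M.T x ∈ tangent κ τ (M.φ x) :=
  Submodule.sub_mem _ (frame_mem_tangent _ 2) (Submodule.smul_mem _ _ (M.N_mem x))

theorem Ttheta_mem_tangent (H : ℝ) (x : S) : M.Ttheta H x ∈ tangent κ τ (M.φ x) :=
  Submodule.add_mem _ (Submodule.smul_mem _ _ (M.T_mem_tangent x))
    (Submodule.smul_mem _ _ (ofCoords_mem_tangent _ _))

theorem shapeAR_mem_tangent (hτ : τ ≠ 0) (H : ℝ) (x : S) (X : TangentSpace (𝓡 2) x) :
    M.shapeAR H x X ∈ tangent κ τ (M.φ x) :=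
  Submodule.sub_mem _ (Submodule.add_mem _ (Submodule.sub_mem _
    (Submodule.neg_mem _ (ofCoords_mem_tangent _ _))
    (Submodule.smul_mem _ _ (M.Ttheta_mem_tangent H x)))
    (Submodule.smul_mem _ _ (M.diff_mem_tangent hτ x X)))
    (Submodule.smul_mem _ _ (M.diff_mem_tangent hτ x X))

theorem nu_eq (hτ : τ ≠ 0) (x : S) : M.nu x = M.normalCoords x ⬝ᵥ ![0, 0, 1] := by
  rw [nu, metric, coframe_xi hτ (M.mem_carrier x)]
  rfl

theorem coframe_T (hτ : τ ≠ 0) (x : S) : coframe κ τ (M.φ x) (M.T x) =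
    ![0, 0, 1] - (M.normalCoords x ⬝ᵥ ![0, 0, 1]) • M.normalCoords x := by
  rw [T, coframe_sub, coframe_smul, coframe_xi hτ (M.mem_carrier x), M.nu_eq hτ]
  rfl

theorem coframe_Ttheta (hτ : τ ≠ 0) (H : ℝ) (x : S) : coframe κ τ (M.φ x) (M.Ttheta H x) =
    rotT (Real.cos (theta H τ)) (Real.sin (theta H τ)) (M.normalCoords x) ![0, 0, 1] := by
  rw [Ttheta, J, wedge, coframe_add, coframe_smul, coframe_smul,
    coframe_ofCoords hτ (M.mem_carrier x), M.coframe_T hτ]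
  rfl

/-! ### The Abresch-Rosenberg operator along a curve -/

variable (γ : ℝ → S)

/-- The coordinates in the frame of the velocity of the curve `φ ∘ γ`. -/
def velCoords (t : ℝ) : Fin 3 → ℝ := coframe κ τ (M.φ (γ t)) (diff M.φ (γ t) (velocity γ t))

/-- The coordinates in the frame of the covariant derivative of the normal along `γ`. -/
def covNormal (t : ℝ) : Fin 3 → ℝ :=
  deriv (fun s => M.normalCoords (γ s)) t +
    connTerm κ τ (M.φ (γ t)) (M.velCoords γ t) (M.normalCoords (γ t))

/-- The coordinates in the frame of `S_AR(γ')`; here `e`, `q` and `w` are the coordinates of `ξ`,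
`𝐓_θ` and `𝐓`. -/
def arCoords (H t : ℝ) : Fin 3 → ℝ :=
  let e : Fin 3 → ℝ := ![0, 0, 1]
  let n := M.normalCoords (γ t)
  let u := M.velCoords γ t
  let q := rotT (Real.cos (theta H τ)) (Real.sin (theta H τ)) n e
  let w := e - (n ⬝ᵥ e) • n;
  -M.covNormal γ t - (alpha κ τ H * (q ⬝ᵥ u)) • q + (alpha κ τ H * (w ⬝ᵥ w) / 2) • u - H • u

variable {γ} {ε : ℝ}

theorem contMDiff_normalCoords (k : Fin 3) :
    ContMDiff (𝓡 2) 𝓘(ℝ, ℝ) ∞ (fun x => M.normalCoords x k) := fun x =>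
  ContMDiffAt.comp (I' := 𝓘(ℝ, V4 × V4)) (g := fun q : V4 × V4 => coframe κ τ q.1 q.2 k)
    (f := fun x => (M.φ x, M.N x)) x
    (contDiffAt_coframe (M.mem_carrier x) _ k).contMDiffAt
    ((M.smooth_φ x).prodMk_space (M.smooth_N x))

theorem diff_velocity (hγ : IsRegularCurve ε γ) {t : ℝ} (ht : t ∈ Set.Ioo (-ε) ε) :
    diff M.φ (γ t) (velocity γ t) = deriv (fun s => M.φ (γ s)) t := by
  have hd : MDifferentiableAt 𝓘(ℝ, ℝ) (𝓡 2) γ t :=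
    (hγ.1.contMDiffAt (isOpen_Ioo.mem_nhds ht)).mdifferentiableAt (by simp)
  have h := mfderiv_comp_apply (I'' := 𝓘(ℝ, V4)) t (g := M.φ) (f := γ)
    (M.mdifferentiableAt_φ _) hd (1 : ℝ)
  rw [mfderiv_eq_fderiv] at h
  exact h.symm.trans (fderiv_apply_one_eq_deriv (𝕜 := ℝ) (f := fun s => M.φ (γ s)))

theorem contDiffOn_normalCoords (hγ : IsRegularCurve ε γ) :
    ContDiffOn ℝ ∞ (fun s => M.normalCoords (γ s)) (Set.Ioo (-ε) ε) :=
  contDiffOn_pi.2 fun k => contDiffOn_comp (M.contMDiff_normalCoords k) hγ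

theorem contDiffOn_velCoords (hγ : IsRegularCurve ε γ) :
    ContDiffOn ℝ ∞ (M.velCoords γ) (Set.Ioo (-ε) ε) := by
  have hp := contDiffOn_comp M.smooth_φ hγ
  have hw : ContDiffOn ℝ ∞ (fun s => diff M.φ (γ s) (velocity γ s)) (Set.Ioo (-ε) ε) :=
    (hp.deriv_of_isOpen isOpen_Ioo (by simp)).congr fun t ht => M.diff_velocity hγ ht
  refine contDiffOn_pi.2 fun k t ht => ?_
  exact (contDiffAt_coframe (M.mem_carrier (γ t)) _ k).comp_contDiffWithinAt
    (f := fun s => (M.φ (γ s), (diff M.φ (γ s) (velocity γ s) : V4))) t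
    ((hp t ht).prodMk (hw t ht))

theorem contDiffOn_covNormal (hγ : IsRegularCurve ε γ) :
    ContDiffOn ℝ ∞ (M.covNormal γ) (Set.Ioo (-ε) ε) := by
  have hp := contDiffOn_comp M.smooth_φ hγ
  have hn := M.contDiffOn_normalCoords hγ
  have hu := M.contDiffOn_velCoords hγ
  refine (hn.deriv_of_isOpen isOpen_Ioo (by simp)).add (contDiffOn_pi.2 fun k => ?_)
  refine ContDiffOn.sum fun i _ => ContDiffOn.sum fun j _ => ?_
  refine ((contDiffOn_pi.1 hu i).mul (contDiffOn_pi.1 hn j)).mul fun t ht => ?_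
  exact (contDiffAt_connCoeff (M.mem_carrier (γ t)) i j k).comp_contDiffWithinAt t (hp t ht)

theorem contDiffOn_arCoords (H : ℝ) (hγ : IsRegularCurve ε γ) :
    ContDiffOn ℝ ∞ (M.arCoords γ H) (Set.Ioo (-ε) ε) := by
  have ha := M.contDiffOn_covNormal hγ
  have hn := M.contDiffOn_normalCoords hγ
  have hu := M.contDiffOn_velCoords hγ
  have he : ContDiffOn ℝ ∞ (fun _ : ℝ => (![0, 0, 1] : Fin 3 → ℝ)) (Set.Ioo (-ε) ε) :=
    contDiffOn_const
  have hw := he.sub ((contDiffOn_dotProduct hn he).smul hn)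
  have hq := (hw.const_smul (Real.cos (theta H τ))).add
    ((contDiffOn_cross hn hw).const_smul (Real.sin (theta H τ)))
  exact ((ha.neg.sub ((contDiffOn_const.mul (contDiffOn_dotProduct hq hu)).smul hq)).add
    (((contDiffOn_const.mul (contDiffOn_dotProduct hw hw)).div_const 2).smul hu)).sub
    (hu.const_smul H)

theorem coframe_shapeAR (hτ : τ ≠ 0) (H : ℝ) (hγ : IsRegularCurve ε γ) {t : ℝ}
    (ht : t ∈ Set.Ioo (-ε) ε) :
    coframe κ τ (M.φ (γ t)) (M.shapeAR H (γ t) (velocity γ t)) = M.arCoords γ H t := by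
  have hA : coframe κ τ (M.φ (γ t)) (M.shape (γ t) (velocity γ t)) = -M.covNormal γ t := by
    rw [shape, coframe_neg, covDeriv, coframe_ofCoords hτ (M.mem_carrier _)]
    congr 1
    ext k
    have hd : DifferentiableAt ℝ (fun s => M.normalCoords (γ s)) t :=
      ((M.contDiffOn_normalCoords hγ).contDiffAt (isOpen_Ioo.mem_nhds ht)).differentiableAt
        (by simp)
    rw [covNormal, Pi.add_apply, deriv_pi (differentiableAt_pi.1 hd)]
    exact congrArg (· + _) (dirDeriv_velocity (M.contMDiff_normalCoords k) hγ ht)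
  rw [shapeAR, coframe_sub, coframe_add, coframe_sub, coframe_smul, coframe_smul, coframe_smul,
    hA, metric, metric, M.coframe_Ttheta hτ, M.coframe_T hτ]
  rfl

theorem velCoords_ne_zero (hτ : τ ≠ 0) (hγ : IsRegularCurve ε γ) {t : ℝ}
    (ht : t ∈ Set.Ioo (-ε) ε) : M.velCoords γ t ≠ 0 := fun h => hγ.2 t ht <| by
  refine M.injective_diff (γ t) ?_
  rw [map_zero]
  refine coframe_injOn hτ (M.mem_carrier _) (M.diff_mem_tangent hτ _ _) (Submodule.zero_mem _) ?_
  exact h.trans (coframeLin κ τ _).map_zero.symm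

end ImmersedSurface

open ImmersedSurface

variable {S' : Type*} [TopologicalSpace S'] [ChartedSpace (EuclideanSpace ℝ (Fin 2)) S']
  {M : ImmersedSurface S κ τ} {M' : ImmersedSurface S' κ τ} {γ : ℝ → S} {δ : ℝ → S'} {ε : ℝ}

/-- If the angle of two surfaces along a common curve is constant, then differentiating
`⟨N, N'⟩` with the metric connection gives `⟨∇N, N'⟩ + ⟨N, ∇N'⟩ = 0`. -/
theorem covNormal_dotProduct_add (hγ : IsRegularCurve ε γ) (hδ : IsRegularCurve ε δ)
    (hφ : ∀ t ∈ Set.Ioo (-ε) ε, M.φ (γ t) = M'.φ (δ t))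
    (hu : ∀ t ∈ Set.Ioo (-ε) ε, M.velCoords γ t = M'.velCoords δ t) {d : ℝ}
    (hd : ∀ t ∈ Set.Ioo (-ε) ε, M.normalCoords (γ t) ⬝ᵥ M'.normalCoords (δ t) = d)
    {t : ℝ} (ht : t ∈ Set.Ioo (-ε) ε) :
    M.covNormal γ t ⬝ᵥ M'.normalCoords (δ t) + M.normalCoords (γ t) ⬝ᵥ M'.covNormal δ t = 0 := by
  have hn : DifferentiableAt ℝ (fun s => M.normalCoords (γ s)) t :=
    ((M.contDiffOn_normalCoords hγ).contDiffAt (isOpen_Ioo.mem_nhds ht)).differentiableAt (by simp)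
  have hn' : DifferentiableAt ℝ (fun s => M'.normalCoords (δ s)) t :=
    ((M'.contDiffOn_normalCoords hδ).contDiffAt (isOpen_Ioo.mem_nhds ht)).differentiableAt
      (by simp)
  have h₁ := (hasDerivAt_dotProduct hn hn').deriv
  have h₂ : (fun s => M.normalCoords (γ s) ⬝ᵥ M'.normalCoords (δ s)) =ᶠ[nhds t] fun _ => d :=
    Filter.eventuallyEq_of_mem (isOpen_Ioo.mem_nhds ht) hd
  rw [h₂.deriv_eq, deriv_const] at h₁
  have h₃ := connTerm_dotProduct_add (κ := κ) (τ := τ) (M.φ (γ t)) (M.velCoords γ t)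
    (M.normalCoords (γ t)) (M'.normalCoords (δ t))
  rw [covNormal, covNormal, ← hφ t ht, ← hu t ht, add_dotProduct, dotProduct_add]
  linarith

theorem covNormal_dotProduct_normal (hγ : IsRegularCurve ε γ) {t : ℝ}
    (ht : t ∈ Set.Ioo (-ε) ε) : M.covNormal γ t ⬝ᵥ M.normalCoords (γ t) = 0 := by
  have h := covNormal_dotProduct_add hγ hγ (fun _ _ => rfl) (fun _ _ => rfl)
    (fun t _ => M.normalCoords_self (γ t)) ht
  rw [dotProduct_comm (M.normalCoords (γ t))] at h
  linarith

/-- A curve is an AR-line of curvature if and only if `⟨S_AR(γ'), Jγ'⟩ = 0`; the factor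
`⟨S_AR(γ'), γ'⟩ / |γ'|²` is then automatically smooth. -/
theorem isARLine_iff (hτ : τ ≠ 0) (H : ℝ) (hγ : IsRegularCurve ε γ) :
    IsARLine M H ε γ ↔ ∀ t ∈ Set.Ioo (-ε) ε,
      M.arCoords γ H t ⬝ᵥ (M.normalCoords (γ t) ⨯₃ M.velCoords γ t) = 0 := by
  constructor
  · rintro ⟨l, -, hl⟩ t ht
    rw [← M.coframe_shapeAR hτ H hγ ht, hl t ht, coframe_smul, smul_dotProduct]
    exact (congrArg (l t • ·) (dot_cross_self _ _)).trans (smul_zero _)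
  · intro h
    refine ⟨fun t => (M.arCoords γ H t ⬝ᵥ M.velCoords γ t) /
      (M.velCoords γ t ⬝ᵥ M.velCoords γ t), ?_, fun t ht => ?_⟩
    · have hu := M.contDiffOn_velCoords hγ
      exact (contDiffOn_dotProduct (M.contDiffOn_arCoords H hγ) hu).div
        (contDiffOn_dotProduct hu hu)
        fun t ht h0 => M.velCoords_ne_zero hτ hγ ht (dotProduct_self_eq_zero.1 h0)
    · refine coframe_injOn hτ (M.mem_carrier _) (M.shapeAR_mem_tangent hτ H _ _)
        (Submodule.smul_mem _ _ (M.diff_mem_tangent hτ _ _)) ?_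
      rw [M.coframe_shapeAR hτ H hγ ht, coframe_smul]
      have hn := M.normalCoords_self (γ t)
      have hu : M.normalCoords (γ t) ⬝ᵥ M.velCoords γ t = 0 := M.normalCoords_diff _ _
      refine eq_smul_of_orthogonal hn hu (M.velCoords_ne_zero hτ hγ ht) ?_ (h t ht)
      simp only [arCoords, add_dotProduct, sub_dotProduct, smul_dotProduct, neg_dotProduct,
        covNormal_dotProduct_normal hγ ht, rotT_dotProduct_normal _ _ _ _ hn,
        dotProduct_comm (M.velCoords γ t), hu]
      simp

/-- The form `⟨S_AR(γ'), Jγ'⟩` in terms of `⟨∇N, Jγ'⟩`, `⟨ξ, γ'⟩` and `⟨ξ, Jγ'⟩`. -/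
theorem arCoords_dotProduct_cross (H t : ℝ) :
    M.arCoords γ H t ⬝ᵥ (M.normalCoords (γ t) ⨯₃ M.velCoords γ t) =
      -(M.covNormal γ t ⬝ᵥ (M.normalCoords (γ t) ⨯₃ M.velCoords γ t)) -
        alpha κ τ H *
          (Real.cos (theta H τ) * (![0, 0, 1] ⬝ᵥ M.velCoords γ t) -
            Real.sin (theta H τ) *
              (![0, 0, 1] ⬝ᵥ (M.normalCoords (γ t) ⨯₃ M.velCoords γ t))) *
          (Real.cos (theta H τ) * (![0, 0, 1] ⬝ᵥ (M.normalCoords (γ t) ⨯₃ M.velCoords γ t)) +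
            Real.sin (theta H τ) * (![0, 0, 1] ⬝ᵥ M.velCoords γ t)) := by
  have hn := M.normalCoords_self (γ t)
  have hu : M.normalCoords (γ t) ⬝ᵥ M.velCoords γ t = 0 := M.normalCoords_diff _ _
  simp only [arCoords, add_dotProduct, sub_dotProduct, smul_dotProduct, neg_dotProduct,
    dot_cross_self, rotT_dotProduct_cross _ _ _ hn hu, rotT_dotProduct _ _ _ hu, smul_eq_mul]
  ring

/-! ### Tangent and transversal surfaces -/

theorem plane_eq_of_dotProduct_sq (hτ : τ ≠ 0) {x : S} {y : S'} (hφ : M.φ x = M'.φ y)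
    (h : (M.normalCoords x ⬝ᵥ M'.normalCoords y) ^ 2 = 1) : M.plane x = M'.plane y := by
  ext v
  rw [M.mem_plane_iff hτ, M'.mem_plane_iff hτ, ← hφ]
  rcases eq_or_eq_neg_of_dotProduct_sq (M.normalCoords_self x) (M'.normalCoords_self y) h
    with h | h <;> simp [h]

theorem plane_sup_eq_tangent (hτ : τ ≠ 0) {x : S} {y : S'} (hφ : M.φ x = M'.φ y)
    (h : (M.normalCoords x ⬝ᵥ M'.normalCoords y) ^ 2 ≠ 1) :
    M.plane x ⊔ M'.plane y = tangent κ τ (M.φ x) := by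
  have hp := M.mem_carrier x
  have hn := M.normalCoords_self x
  have hn' := M'.normalCoords_self y
  refine le_antisymm (sup_le (fun v hv => ((M.mem_plane_iff hτ x v).1 hv).1)
    fun v hv => hφ ▸ ((M'.mem_plane_iff hτ y v).1 hv).1) fun v hv => ?_
  set n := M.normalCoords x
  set m := M'.normalCoords y
  have hd : 1 - (n ⬝ᵥ m) ^ 2 ≠ 0 := fun h' => h (by linarith)
  -- the vector of the plane orthogonal to `m` whose component along `n` is that of `v`
  set b : Fin 3 → ℝ := ((n ⬝ᵥ coframe κ τ (M.φ x) v) / (1 - (n ⬝ᵥ m) ^ 2)) • (n - (n ⬝ᵥ m) • m)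
    with hb
  have hw := coframe_ofCoords hτ hp b
  have hmem := ofCoords_mem_tangent (κ := κ) (τ := τ) (M.φ x) b
  refine Submodule.mem_sup.2 ⟨v - ofCoords κ τ (M.φ x) b, ?_, ofCoords κ τ (M.φ x) b, ?_,
    sub_add_cancel _ _⟩
  · refine (M.mem_plane_iff hτ x _).2 ⟨Submodule.sub_mem _ hv hmem, ?_⟩
    change n ⬝ᵥ _ = 0
    rw [coframe_sub, hw, dotProduct_sub, hb, dotProduct_smul, dotProduct_sub, dotProduct_smul, hn,
      smul_eq_mul, smul_eq_mul]
    field_simp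
    ring
  · refine (M'.mem_plane_iff hτ y _).2 ⟨hφ ▸ hmem, ?_⟩
    change m ⬝ᵥ _ = 0
    rw [← hφ, hw, hb, dotProduct_smul, dotProduct_sub, dotProduct_smul, hn', dotProduct_comm m n]
    simp

/-! ### Two surfaces meeting along a curve -/

theorem velCoords_eq (hγ : IsRegularCurve ε γ) (hδ : IsRegularCurve ε δ)
    (hφ : ∀ t ∈ Set.Ioo (-ε) ε, M.φ (γ t) = M'.φ (δ t)) {t : ℝ} (ht : t ∈ Set.Ioo (-ε) ε) :
    M.velCoords γ t = M'.velCoords δ t := by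
  have h : (fun s => M.φ (γ s)) =ᶠ[nhds t] fun s => M'.φ (δ s) :=
    Filter.eventuallyEq_of_mem (isOpen_Ioo.mem_nhds ht) hφ
  rw [velCoords, velCoords, hφ t ht]
  exact congrArg _ ((M.diff_velocity hγ ht).trans (h.deriv_eq.trans (M'.diff_velocity hδ ht).symm))

theorem arCoords_eq_of_normal_eq (H : ℝ) (hγ : IsRegularCurve ε γ) (hδ : IsRegularCurve ε δ)
    (hφ : ∀ t ∈ Set.Ioo (-ε) ε, M.φ (γ t) = M'.φ (δ t))
    (hN : ∀ t ∈ Set.Ioo (-ε) ε, M.normalCoords (γ t) = M'.normalCoords (δ t))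
    {t : ℝ} (ht : t ∈ Set.Ioo (-ε) ε) : M.arCoords γ H t = M'.arCoords δ H t := by
  have h : (fun s => M.normalCoords (γ s)) =ᶠ[nhds t] fun s => M'.normalCoords (δ s) :=
    Filter.eventuallyEq_of_mem (isOpen_Ioo.mem_nhds ht) hN
  have hu := velCoords_eq hγ hδ hφ ht
  have ha : M.covNormal γ t = M'.covNormal δ t := by
    rw [covNormal, covNormal, h.deriv_eq, hφ t ht, hu, hN t ht]
  rw [arCoords, arCoords, ha, hN t ht, hu]

/-- Where two surfaces meet transversally at a constant angle with opposite angle functions, the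
forms `⟨S_AR(γ'), Jγ'⟩` of the two surfaces agree. -/
theorem arCoords_dotProduct_cross_eq (hτ : τ ≠ 0) (H : ℝ) (hγ : IsRegularCurve ε γ)
    (hδ : IsRegularCurve ε δ) (hφ : ∀ t ∈ Set.Ioo (-ε) ε, M.φ (γ t) = M'.φ (δ t)) {d : ℝ}
    (hd : ∀ t ∈ Set.Ioo (-ε) ε, M.normalCoords (γ t) ⬝ᵥ M'.normalCoords (δ t) = d)
    (hd1 : d ^ 2 ≠ 1) {t : ℝ} (ht : t ∈ Set.Ioo (-ε) ε) (hν : M.nu (γ t) = -M'.nu (δ t)) :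
    M.arCoords γ H t ⬝ᵥ (M.normalCoords (γ t) ⨯₃ M.velCoords γ t) =
      M'.arCoords δ H t ⬝ᵥ (M'.normalCoords (δ t) ⨯₃ M'.velCoords δ t) := by
  have hu : ∀ t ∈ Set.Ioo (-ε) ε, M.velCoords γ t = M'.velCoords δ t :=
    fun t ht => velCoords_eq hγ hδ hφ ht
  rw [M.nu_eq hτ, M'.nu_eq hτ] at hν
  obtain ⟨h₁, h₂⟩ := dotProduct_cross_eq (M.normalCoords_self (γ t)) (M'.normalCoords_self (δ t))
    (by rwa [hd t ht]) (M.normalCoords_diff _ (velocity γ t))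
    ((congrArg _ (hu t ht)).trans (M'.normalCoords_diff _ (velocity δ t)))
    (covNormal_dotProduct_normal hγ ht) (covNormal_dotProduct_normal hδ ht)
    (covNormal_dotProduct_add hγ hδ hφ hu hd ht) hν
  change _ ⬝ᵥ (_ ⨯₃ M.velCoords γ t) = _ ⬝ᵥ (_ ⨯₃ M.velCoords γ t) at h₁ h₂
  rw [arCoords_dotProduct_cross, arCoords_dotProduct_cross, ← hu t ht, h₁, h₂]

end Surface

end EKT

end

theorem mainTheorem5 (κ τ H : ℝ) (hτ : τ ≠ 0) (hκτ : κ - 4 * τ ^ 2 ≠ 0)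
    {S₁ : Type*} [TopologicalSpace S₁] [ChartedSpace (EuclideanSpace ℝ (Fin 2)) S₁]
    [IsManifold (𝓡 2) ∞ S₁]
    {S₂ : Type*} [TopologicalSpace S₂] [ChartedSpace (EuclideanSpace ℝ (Fin 2)) S₂]
    [IsManifold (𝓡 2) ∞ S₂]
    (M₁ : EKT.ImmersedSurface S₁ κ τ) (M₂ : EKT.ImmersedSurface S₂ κ τ)
    (hM₁ : M₁.IsHSurface H) (hM₂ : M₂.IsHSurface H)
    -- the curve `Γ ⊂ Σ₁ ∩ Σ₂`, as a curve in each of the two surfaces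
    (ε : ℝ) (hε : 0 < ε) (γ₁ : ℝ → S₁) (γ₂ : ℝ → S₂)
    (hγ₁ : EKT.IsRegularCurve ε γ₁) (hγ₂ : EKT.IsRegularCurve ε γ₂)
    (hγ : ∀ t ∈ Set.Ioo (-ε) ε, M₁.φ (γ₁ t) = M₂.φ (γ₂ t))
    -- constant angle along `Γ`
    (hangle : ∃ d : ℝ, ∀ t ∈ Set.Ioo (-ε) ε,
      EKT.metric κ τ (M₁.φ (γ₁ t)) (M₁.N (γ₁ t)) (M₂.N (γ₂ t)) = d)
    -- if the surfaces are tangent along `Γ`, then `N₁ = N₂` along `Γ`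
    (htangent : (∀ t ∈ Set.Ioo (-ε) ε, M₁.plane (γ₁ t) = M₂.plane (γ₂ t)) →
      ∀ t ∈ Set.Ioo (-ε) ε, M₁.N (γ₁ t) = M₂.N (γ₂ t))
    -- if the surfaces are transversal along `Γ`, then `ν₁ = -ν₂` along `Γ`
    (htransversal : (∀ t ∈ Set.Ioo (-ε) ε,
        M₁.plane (γ₁ t) ⊔ M₂.plane (γ₂ t) = EKT.tangent κ τ (M₁.φ (γ₁ t))) →
      ∀ t ∈ Set.Ioo (-ε) ε, M₁.nu (γ₁ t) = -M₂.nu (γ₂ t)) :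
    EKT.IsARLine M₁ H ε γ₁ ↔ EKT.IsARLine M₂ H ε γ₂ := by
  obtain ⟨d, hangle⟩ := hangle
  have hd : ∀ t ∈ Set.Ioo (-ε) ε, M₁.normalCoords (γ₁ t) ⬝ᵥ M₂.normalCoords (γ₂ t) = d := by
    intro t ht
    rw [← hangle t ht, EKT.metric, EKT.ImmersedSurface.normalCoords,
      EKT.ImmersedSurface.normalCoords, hγ t ht]
  rw [EKT.isARLine_iff hτ H hγ₁, EKT.isARLine_iff hτ H hγ₂]
  refine forall₂_congr fun t ht => ?_
  -- the angle is constant, so the surfaces are either tangent everywhere along the curve or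
  -- transversal everywhere along it
  by_cases hd1 : d ^ 2 = 1
  · have hN := htangent fun t ht =>
      EKT.plane_eq_of_dotProduct_sq hτ (hγ t ht) (by rwa [hd t ht])
    have hN' : ∀ t ∈ Set.Ioo (-ε) ε, M₁.normalCoords (γ₁ t) = M₂.normalCoords (γ₂ t) := by
      intro t ht
      rw [EKT.ImmersedSurface.normalCoords, EKT.ImmersedSurface.normalCoords, hγ t ht, hN t ht]
    rw [EKT.arCoords_eq_of_normal_eq H hγ₁ hγ₂ hγ hN' ht, hN' t ht,
      EKT.velCoords_eq hγ₁ hγ₂ hγ ht]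
  · have hν := htransversal fun t ht =>
      EKT.plane_sup_eq_tangent hτ (hγ t ht) (by rwa [hd t ht])
    rw [EKT.arCoords_dotProduct_cross_eq hτ H hγ₁ hγ₂ hγ hd hd1 ht (hν t ht)]
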